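/- Let $\mu$ be a non-trivial measure on $\mathbb{R}$ (infinite support) with $\int|x|^n\,d\mu<\infty$ for all $n\ge 0$. Let $P_n$ and $p_n=P_n/\|P_n\|$ be its monic and orthonormal polynomials in $L^2(\mathbb{R},\mu)$, let $a_n=\|P_n\|/\|P_{n-1}\|$ and $b_n=\langle x p_{n-1},p_{n-1}\rangle$ $(n\ge 1)$ be its recurrence coefficients, and put $$A_j(x)=a_j^{-1}\begin{pmatrix}x-b_j&-1\\a_j^2&0\end{pmatrix}\ (j\ge1),\qquad A_\infty(x)=a^{-1}\begin{pmatrix}x-b&-1\\a^2&0\end{pmatrix}.$$ Suppose that $\mu$ is in the Nevai class $\mathcal{M}(a,b)$ with $a\neq 0$, that is, $a_n\to a\ne0$ and $b_n\to b$, that $\sum_n\left(|a_{n+1}-a_n|+|b_{n+1}-b_n|\right)<\infty$, and that $x_0\in\mathbb{R}\setminus[b-2a,b+2a]$. Then $A_\infty(x_0)$ has exactly one real eigenvalue $\lambda^-$ with $|\lambda^-|<1$, and for all sufficiently large $j$ the matrix $A_j(x_0)$ has exactly one real eigenvalue $\lambda_j^+$ with $|\lambda_j^+|>1$. Moreover: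 1. $\mu(\{x_0\})>0$ if and only if for every $\epsilon>0$ there is a constant $C_\epsilon$ such that $|p_n(x_0)|\le C_\epsilon(|\lambda^-|+\epsilon)^n$ for all $n\ge 0$. 2. Let $N\ge0$ be any integer such that $A_j(x_0)$ has a real eigenvalue $\lambda_j^+$ with $|\lambda_j^+|>1$ for every $j>N$. Then $\mu(\{x_0\})=0$ if and only if there is a real sequence $(k_n)_{n\ge0}$ of bounded variation (i.e. $\sum_n|k_{n+1}-k_n|<\infty$), converging to a non-zero limit, such that $$p_n(x_0)=\Big(\prod_{N<j\le n}\lambda_j^+\Big)k_n\qquad\text{for all } n\ge 0,$$ where the product is $1$ for $n\le N$. -/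

import Mathlib

open MeasureTheory Filter Topology Polynomial

noncomputable section

namespace OPRL

/-- A non-trivial measure on `ℝ` with finite moments: all powers of `|x|` (including the zeroth)
are integrable and the support is an infinite set. -/
structure IsNontrivialMomentMeasure (μ : Measure ℝ) : Prop where
  integrable_pow : ∀ n : ℕ, Integrable (fun x : ℝ => |x| ^ n) μ
  support_infinite : μ.support.Infinite

/-- The inner product of two real polynomials in `L²(ℝ, μ)`. -/
def polyInner (μ : Measure ℝ) (f g : ℝ[X]) : ℝ :=
  ∫ x, f.eval x * g.eval x ∂μ

/-- The norm of a real polynomial in `L²(ℝ, μ)`. -/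
def polyNorm (μ : Measure ℝ) (f : ℝ[X]) : ℝ :=
  Real.sqrt (polyInner μ f f)

/-- The monic orthogonal polynomials `P_n`: the Gram–Schmidt process applied to
`1, x, x², …`. -/
def monicOP (μ : Measure ℝ) (n : ℕ) : ℝ[X] :=
  X ^ n - ∑ k : Fin n,
    C (polyInner μ (monicOP μ k) (X ^ n) / polyInner μ (monicOP μ k) (monicOP μ k)) *
      monicOP μ k
termination_by n
decreasing_by exact k.isLt

/-- The orthonormal polynomials `p_n = P_n / ‖P_n‖`. -/
def orthonormalP (μ : Measure ℝ) (n : ℕ) : ℝ[X] :=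
  C (polyNorm μ (monicOP μ n))⁻¹ * monicOP μ n

/-- The recurrence coefficient `a_n = ‖P_n‖ / ‖P_{n-1}‖`, meaningful for `n ≥ 1`. -/
def recA (μ : Measure ℝ) (n : ℕ) : ℝ :=
  polyNorm μ (monicOP μ n) / polyNorm μ (monicOP μ (n - 1))

/-- The recurrence coefficient `b_n = ⟨x p_{n-1}, p_{n-1}⟩`, meaningful for `n ≥ 1`. -/
def recB (μ : Measure ℝ) (n : ℕ) : ℝ :=
  polyInner μ (X * orthonormalP μ (n - 1)) (orthonormalP μ (n - 1))

/-- The Nevai class `M(a,b)`: the recurrence coefficients satisfy `a_n → a` and `b_n → b`. -/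
def NevaiClass (a b : ℝ) : Set (Measure ℝ) :=
  {μ | IsNontrivialMomentMeasure μ ∧
    Tendsto (recA μ) atTop (𝓝 a) ∧ Tendsto (recB μ) atTop (𝓝 b)}

/-- A real sequence is of bounded variation: `∑ |u_{n+1} - u_n| < ∞`. -/
def IsBV (u : ℕ → ℝ) : Prop :=
  Summable fun n : ℕ => |u (n + 1) - u n|

/-- The one-step matrix `α⁻¹ (x - β, -1; α², 0)`. -/
def stepMatrix (α β x : ℝ) : Matrix (Fin 2) (Fin 2) ℝ :=
  α⁻¹ • !![x - β, -1; α ^ 2, 0]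

/-- The recurrence matrix `A_j(x)`, for `j ≥ 1`. -/
def recMatrix (μ : Measure ℝ) (j : ℕ) (x : ℝ) : Matrix (Fin 2) (Fin 2) ℝ :=
  stepMatrix (recA μ j) (recB μ j) x

/-- `z` is an eigenvalue of `M` of absolute value greater than `1`. -/
def IsExpandingEigenvalue (M : Matrix (Fin 2) (Fin 2) ℝ) (z : ℝ) : Prop :=
  Module.End.HasEigenvalue (Matrix.toLin' M) z ∧ 1 < |z|

/-- `z` is an eigenvalue of `M` of absolute value less than `1`. -/
def IsContractingEigenvalue (M : Matrix (Fin 2) (Fin 2) ℝ) (z : ℝ) : Prop :=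
  Module.End.HasEigenvalue (Matrix.toLin' M) z ∧ |z| < 1

end OPRL

end

/-! Two facts combine. First, when `a_n` converges, `x₀` is an atom exactly when `∑ p_n(x₀)²`
converges. One direction restricts `∫ K_n²` to the atom, where `K_n` is the Christoffel–Darboux
kernel (`summable_sq_of_atom`). In the other (`atom_of_summable_sq`), `K_n` has integral 1 and
bounded `L²` norm, while `‖(x - x₀) K_n‖ → 0`; this is impossible without mass at `x₀`.

Second, `A_j(x₀)` has determinant 1 and trace `t_j = (x₀ - b_j)/a_j`, whose limit has absolute value
above 2. So for large `j` the eigenvalues are `λ_j` and `λ_j⁻¹` with `|λ_j| > 1`. Write `p_n(x₀) =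
(∏ λ_j) k_n`. The increments of `k` contract by `λ_j⁻²` up to a summable error, so `k` has bounded
variation and a limit `l` (`ratio_isBV_and_decay`).

If `l ≠ 0`, then `p_n(x₀)` does not tend to zero and there is no atom. If `l = 0`, the tail
variation of `k` dominates `|k_n|` and shrinks at a rate near `(λ⁻)²`, while the product grows at a
rate near `|λ⁻|⁻¹`. Hence `p_n(x₀)` decays almost like `|λ⁻|^n`, which is square summable, and `x₀`
is an atom. Both equivalences follow from this dichotomy. -/

noncomputable section

namespace OPRL

/-! ### The inner product on polynomials. -/

variable {μ : Measure ℝ}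

theorem IsNontrivialMomentMeasure.isFiniteMeasure (h : IsNontrivialMomentMeasure μ) :
    IsFiniteMeasure μ := by
  have h0 := h.integrable_pow 0
  simp only [pow_zero] at h0
  exact (integrable_const_iff_isFiniteMeasure one_ne_zero).1 h0

theorem IsNontrivialMomentMeasure.integrable_eval (h : IsNontrivialMomentMeasure μ)
    (f : ℝ[X]) : Integrable (fun x => f.eval x) μ := by
  simp only [eval_eq_sum_range]
  refine integrable_finsetSum _ fun i _ => Integrable.const_mul ?_ _
  refine (h.integrable_pow i).mono' (by fun_prop) (ae_of_all _ fun x => ?_)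
  simp

theorem IsNontrivialMomentMeasure.integrable_eval_mul (h : IsNontrivialMomentMeasure μ)
    (f g : ℝ[X]) : Integrable (fun x => f.eval x * g.eval x) μ := by
  simpa using h.integrable_eval (f * g)

theorem polyInner_comm (f g : ℝ[X]) : polyInner μ f g = polyInner μ g f := by
  simp only [polyInner, mul_comm]

theorem polyInner_X_mul (f g : ℝ[X]) : polyInner μ (X * f) g = polyInner μ f (X * g) := by
  simp only [polyInner, eval_mul, eval_X]
  congr 1; ext x; ring

/-- The inner product as a linear functional of its first argument. -/
def polyInnerLeft (h : IsNontrivialMomentMeasure μ) (g : ℝ[X]) : ℝ[X] →ₗ[ℝ] ℝ where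
  toFun f := polyInner μ f g
  map_add' f₁ f₂ := by
    simp only [polyInner, eval_add, add_mul]
    exact integral_add (h.integrable_eval_mul _ _) (h.integrable_eval_mul _ _)
  map_smul' c f := by
    simp only [polyInner, eval_smul, smul_eq_mul, mul_assoc, RingHom.id_apply]
    exact integral_const_mul _ _

section

variable (h : IsNontrivialMomentMeasure μ)
include h

theorem polyInner_add_left (f₁ f₂ g : ℝ[X]) :
    polyInner μ (f₁ + f₂) g = polyInner μ f₁ g + polyInner μ f₂ g :=
  (polyInnerLeft h g).map_add f₁ f₂

theorem polyInner_sub_left (f₁ f₂ g : ℝ[X]) :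
    polyInner μ (f₁ - f₂) g = polyInner μ f₁ g - polyInner μ f₂ g :=
  (polyInnerLeft h g).map_sub f₁ f₂

theorem polyInner_C_mul_left (c : ℝ) (f g : ℝ[X]) :
    polyInner μ (C c * f) g = c * polyInner μ f g := by
  rw [← smul_eq_C_mul]
  exact (polyInnerLeft h g).map_smul c f

theorem polyInner_C_mul_right (c : ℝ) (f g : ℝ[X]) :
    polyInner μ f (C c * g) = c * polyInner μ f g := by
  rw [polyInner_comm, polyInner_C_mul_left h, polyInner_comm]

theorem polyInner_sum_left {ι : Type*} (s : Finset ι) (f : ι → ℝ[X]) (g : ℝ[X]) :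
    polyInner μ (∑ i ∈ s, f i) g = ∑ i ∈ s, polyInner μ (f i) g :=
  map_sum (polyInnerLeft h g) f s

theorem polyInner_add_right (f g₁ g₂ : ℝ[X]) :
    polyInner μ f (g₁ + g₂) = polyInner μ f g₁ + polyInner μ f g₂ := by
  simp only [polyInner_comm f, polyInner_add_left h]

theorem polyInner_sub_right (f g₁ g₂ : ℝ[X]) :
    polyInner μ f (g₁ - g₂) = polyInner μ f g₁ - polyInner μ f g₂ := by
  simp only [polyInner_comm f, polyInner_sub_left h]

theorem polyInner_sum_right {ι : Type*} (s : Finset ι) (f : ℝ[X]) (g : ι → ℝ[X]) :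
    polyInner μ f (∑ i ∈ s, g i) = ∑ i ∈ s, polyInner μ f (g i) := by
  simp only [polyInner_comm f, polyInner_sum_left h]

/-- If the integral vanished, the closed zero set of `f` would have full measure and so contain the
infinite support; but `f` has finitely many roots. -/
theorem polyInner_self_pos {f : ℝ[X]} (hf : f ≠ 0) : 0 < polyInner μ f f := by
  have hnn : 0 ≤ fun x => f.eval x * f.eval x := fun x => mul_self_nonneg _
  refine lt_of_le_of_ne (integral_nonneg hnn) fun h0 => ?_
  have hae := (integral_eq_zero_iff_of_nonneg hnn (h.integrable_eval_mul f f)).1 h0.symm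
  have hmem : {x | f.eval x = 0} ∈ ae μ := by
    filter_upwards [hae] with x hx
    simpa using hx
  have hcl : IsClosed {x | f.eval x = 0} := isClosed_eq f.continuous continuous_const
  have hsub := Measure.support_subset_of_isClosed hcl hmem
  refine h.support_infinite (Set.Finite.subset ?_ hsub)
  refine (f.roots.toFinset.finite_toSet).subset fun x hx => ?_
  simpa [hf] using hx

end

/-! ### Monic and orthonormal polynomials and the three-term recurrence. -/

theorem degree_C_mul_le_degree (c : ℝ) (f : ℝ[X]) : (C c * f).degree ≤ f.degree := by
  rw [← smul_eq_C_mul]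
  exact degree_smul_le c f

theorem monicOP_eq (μ : Measure ℝ) (n : ℕ) : monicOP μ n = X ^ n - ∑ k ∈ Finset.range n,
    C (polyInner μ (monicOP μ k) (X ^ n) / polyInner μ (monicOP μ k) (monicOP μ k)) *
      monicOP μ k := by
  rw [monicOP, Finset.sum_range fun k =>
    C (polyInner μ (monicOP μ k) (X ^ n) / polyInner μ (monicOP μ k) (monicOP μ k)) *
      monicOP μ k]

theorem degree_monicOP_sub_X_pow_lt (μ : Measure ℝ) (n : ℕ) :
    (monicOP μ n - X ^ n).degree < (n : WithBot ℕ) := by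
  induction n using Nat.strong_induction_on with
  | _ n ih =>
    rw [monicOP_eq, sub_sub_cancel_left, degree_neg]
    refine (degree_sum_le _ _).trans_lt ((Finset.sup_lt_iff (WithBot.bot_lt_coe _)).2 ?_)
    intro k hk
    have hk := Finset.mem_range.1 hk
    refine (degree_C_mul_le_degree _ _).trans_lt ?_
    have : monicOP μ k = (monicOP μ k - X ^ k) + X ^ k := by ring
    rw [this]
    refine (degree_add_le _ _).trans_lt (max_lt ((ih k hk).trans ?_) ?_)
    · exact_mod_cast hk
    · rw [degree_X_pow]; exact_mod_cast hk

theorem monicOP_eq_add (μ : Measure ℝ) (n : ℕ) :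
    monicOP μ n = X ^ n + (monicOP μ n - X ^ n) := by ring

theorem monic_monicOP (μ : Measure ℝ) (n : ℕ) : (monicOP μ n).Monic := by
  rw [monicOP_eq_add]
  exact monic_X_pow_add (degree_monicOP_sub_X_pow_lt μ n)

theorem degree_monicOP (μ : Measure ℝ) (n : ℕ) : (monicOP μ n).degree = n := by
  rw [monicOP_eq_add, degree_add_eq_left_of_degree_lt] <;> simp [degree_monicOP_sub_X_pow_lt]

theorem degree_X_mul_monicOP_sub_lt (μ : Measure ℝ) (n : ℕ) :
    (X * monicOP μ n - monicOP μ (n + 1)).degree < ((n + 1 : ℕ) : WithBot ℕ) := by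
  have hd : (X * monicOP μ n).degree = ((n + 1 : ℕ) : WithBot ℕ) := by
    rw [degree_mul, degree_X, degree_monicOP]; push_cast; ring
  rw [← hd]
  refine degree_sub_lt_left (by rw [hd, degree_monicOP]) ?_ ?_
  · exact mul_ne_zero X_ne_zero (monic_monicOP μ n).ne_zero
  · rw [(monic_X.mul (monic_monicOP μ n)).leadingCoeff, (monic_monicOP μ _).leadingCoeff]

section

variable (h : IsNontrivialMomentMeasure μ)
include h

theorem polyInner_monicOP_self_pos (n : ℕ) : 0 < polyInner μ (monicOP μ n) (monicOP μ n) :=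
  polyInner_self_pos h (monic_monicOP μ n).ne_zero

theorem polyInner_monicOP_of_lt (n : ℕ) :
    ∀ m < n, polyInner μ (monicOP μ m) (monicOP μ n) = 0 := by
  induction n using Nat.strong_induction_on with
  | _ n ih =>
    intro m hm
    conv_lhs => rw [monicOP_eq μ n]
    rw [polyInner_sub_right h, polyInner_sum_right h, Finset.sum_eq_single m]
    · rw [polyInner_C_mul_right h, div_mul_cancel₀ _ (polyInner_monicOP_self_pos h m).ne',
        sub_self]
    · intro k hk hkm
      rw [polyInner_C_mul_right h]
      rcases lt_or_gt_of_ne hkm with hlt | hlt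
      · rw [polyInner_comm (monicOP μ m), ih m hm k hlt, mul_zero]
      · rw [ih k (Finset.mem_range.1 hk) m hlt, mul_zero]
    · intro hm'
      exact absurd (Finset.mem_range.2 hm) hm'

theorem polyInner_monicOP_of_ne {m n : ℕ} (hmn : m ≠ n) :
    polyInner μ (monicOP μ m) (monicOP μ n) = 0 := by
  rcases lt_or_gt_of_ne hmn with hlt | hlt
  · exact polyInner_monicOP_of_lt h n m hlt
  · rw [polyInner_comm]; exact polyInner_monicOP_of_lt h m n hlt

/-- Peels off the top coefficient of `f` with a multiple of the monic `P_n`. As `g` is arbitrary, `g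
= P_n` gives orthogonality to lower degrees, and `f = g` gives nondegeneracy. -/
theorem polyInner_eq_zero_of_degree_lt {g : ℝ[X]} (n : ℕ)
    (hg : ∀ k < n, polyInner μ g (monicOP μ k) = 0) :
    ∀ f : ℝ[X], f.degree < n → polyInner μ g f = 0 := by
  induction n with
  | zero =>
    intro f hf
    have : f = 0 := by simpa using hf
    simp [this, polyInner]
  | succ n ih =>
    intro f hf
    have hfe : f = (f - C (f.coeff n) * monicOP μ n) + C (f.coeff n) * monicOP μ n := by ring
    rw [hfe, polyInner_add_right h, polyInner_C_mul_right h, hg n (Nat.lt_succ_self n),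
      mul_zero, add_zero]
    refine ih (fun k hk => hg k (hk.trans (Nat.lt_succ_self n))) _ ?_
    rw [degree_lt_iff_coeff_zero] at hf ⊢
    intro m hm
    have hlead : (monicOP μ n).coeff n = 1 := by
      have := (monic_monicOP μ n).coeff_natDegree
      rwa [natDegree_eq_of_degree_eq_some (degree_monicOP μ n)] at this
    rcases hm.eq_or_lt with rfl | hlt
    · simp [hlead]
    · rw [coeff_sub, coeff_C_mul, hf m hlt, coeff_eq_zero_of_degree_lt (p := monicOP μ n)]
      · simp
      · rw [degree_monicOP]; exact_mod_cast hlt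

theorem polyInner_monicOP_eq_zero_of_degree_lt (n : ℕ) {f : ℝ[X]} (hf : f.degree < n) :
    polyInner μ (monicOP μ n) f = 0 :=
  polyInner_eq_zero_of_degree_lt h n (fun _ hk => polyInner_monicOP_of_ne h hk.ne') f hf

theorem eq_zero_of_polyInner_monicOP {g : ℝ[X]} (n : ℕ) (hdeg : g.degree < n)
    (hg : ∀ k < n, polyInner μ g (monicOP μ k) = 0) : g = 0 := by
  by_contra hne
  exact (polyInner_self_pos h hne).ne' (polyInner_eq_zero_of_degree_lt h n hg g hdeg)

theorem polyInner_X_mul_monicOP_succ (n : ℕ) :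
    polyInner μ (X * monicOP μ n) (monicOP μ (n + 1)) =
      polyInner μ (monicOP μ (n + 1)) (monicOP μ (n + 1)) := by
  rw [← sub_eq_zero, ← polyInner_sub_left h, polyInner_comm]
  exact polyInner_monicOP_eq_zero_of_degree_lt h _ (degree_X_mul_monicOP_sub_lt μ n)

theorem polyInner_X_mul_monicOP_of_lt {k n : ℕ} (hk : k + 1 < n) :
    polyInner μ (X * monicOP μ n) (monicOP μ k) = 0 := by
  rw [polyInner_X_mul]
  refine polyInner_monicOP_eq_zero_of_degree_lt h n ?_
  rw [degree_mul, degree_X, degree_monicOP]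
  have : (1 : WithBot ℕ) + k = ((k + 1 : ℕ) : WithBot ℕ) := by push_cast; ring
  rw [this]; exact_mod_cast hk

/-- The three-term recurrence for the monic orthogonal polynomials. -/
theorem X_mul_monicOP (n : ℕ) :
    X * monicOP μ (n + 1) = monicOP μ (n + 2) +
      C (polyInner μ (X * monicOP μ (n + 1)) (monicOP μ (n + 1)) /
        polyInner μ (monicOP μ (n + 1)) (monicOP μ (n + 1))) * monicOP μ (n + 1) +
      C (polyInner μ (monicOP μ (n + 1)) (monicOP μ (n + 1)) /
        polyInner μ (monicOP μ n) (monicOP μ n)) * monicOP μ n := by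
  set β := polyInner μ (X * monicOP μ (n + 1)) (monicOP μ (n + 1)) /
        polyInner μ (monicOP μ (n + 1)) (monicOP μ (n + 1)) with hβ
  set γ := polyInner μ (monicOP μ (n + 1)) (monicOP μ (n + 1)) /
        polyInner μ (monicOP μ n) (monicOP μ n) with hγ
  -- The leading terms cancel, so the residual has degree below `n + 2`; it vanishes once orthogonal
  -- to `P_0, …, P_{n+1}`. `β` and `γ` handle `P_{n+1}` and `P_n`; for lower indices, moving `X`
  -- across the inner product suffices.
  have key : (X * monicOP μ (n + 1) - monicOP μ (n + 2)) - C β * monicOP μ (n + 1) -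
      C γ * monicOP μ n = 0 := by
    refine eq_zero_of_polyInner_monicOP h (n + 2) ?_ fun k hk => ?_
    · refine (degree_sub_le _ _).trans_lt (max_lt ((degree_sub_le _ _).trans_lt (max_lt
        (degree_X_mul_monicOP_sub_lt μ (n + 1)) ?_)) ?_) <;>
      · refine (degree_C_mul_le_degree _ _).trans_lt ?_
        rw [degree_monicOP]
        exact_mod_cast (by omega)
    · simp only [polyInner_sub_left h, polyInner_C_mul_left h]
      rw [polyInner_monicOP_of_ne h (show n + 2 ≠ k by omega)]
      obtain rfl | rfl | hlt : k = n + 1 ∨ k = n ∨ k < n := by omega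
      · rw [polyInner_monicOP_of_ne h (show n ≠ n + 1 by omega), hβ,
          div_mul_cancel₀ _ (polyInner_monicOP_self_pos h _).ne']
        ring
      · rw [polyInner_monicOP_of_ne h (show k + 1 ≠ k by omega), hγ,
          div_mul_cancel₀ _ (polyInner_monicOP_self_pos h _).ne', polyInner_X_mul,
          polyInner_comm, polyInner_X_mul_monicOP_succ h]
        ring
      · rw [polyInner_monicOP_of_ne h (show n + 1 ≠ k by omega),
          polyInner_monicOP_of_ne h (show n ≠ k by omega),
          polyInner_X_mul_monicOP_of_lt h (show k + 1 < n + 1 by omega)]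
        ring
  linear_combination key

theorem X_mul_monicOP_zero :
    X * monicOP μ 0 = monicOP μ 1 +
      C (polyInner μ (X * monicOP μ 0) (monicOP μ 0) /
        polyInner μ (monicOP μ 0) (monicOP μ 0)) * monicOP μ 0 := by
  have key : (X * monicOP μ 0 - monicOP μ 1) - C (polyInner μ (X * monicOP μ 0) (monicOP μ 0) /
        polyInner μ (monicOP μ 0) (monicOP μ 0)) * monicOP μ 0 = 0 := by
    refine eq_zero_of_polyInner_monicOP h 1 ?_ fun k hk => ?_
    · refine (degree_sub_le _ _).trans_lt (max_lt (degree_X_mul_monicOP_sub_lt μ 0) ?_)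
      refine (degree_C_mul_le_degree _ _).trans_lt ?_
      rw [degree_monicOP]
      exact_mod_cast Nat.zero_lt_one
    · obtain rfl : k = 0 := by omega
      simp only [polyInner_sub_left h, polyInner_C_mul_left h]
      rw [polyInner_monicOP_of_ne h one_ne_zero,
          div_mul_cancel₀ _ (polyInner_monicOP_self_pos h _).ne']
      ring
  linear_combination key

theorem polyNorm_monicOP_pos (n : ℕ) : 0 < polyNorm μ (monicOP μ n) :=
  Real.sqrt_pos.2 (polyInner_monicOP_self_pos h n)

theorem sq_polyNorm_monicOP (n : ℕ) :
    polyNorm μ (monicOP μ n) ^ 2 = polyInner μ (monicOP μ n) (monicOP μ n) :=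
  Real.sq_sqrt (polyInner_monicOP_self_pos h n).le

/-- Index 0 is included: truncated subtraction makes the ratio there equal to 1. -/
theorem recA_pos (n : ℕ) : 0 < recA μ n :=
  div_pos (polyNorm_monicOP_pos h _) (polyNorm_monicOP_pos h _)

theorem polyInner_orthonormalP (m n : ℕ) :
    polyInner μ (orthonormalP μ m) (orthonormalP μ n) = if m = n then 1 else 0 := by
  rw [orthonormalP, orthonormalP, polyInner_C_mul_left h, polyInner_C_mul_right h]
  split_ifs with hmn
  · subst hmn
    rw [← sq_polyNorm_monicOP h]
    have := (polyNorm_monicOP_pos h m).ne'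
    field_simp
  · rw [polyInner_monicOP_of_ne h hmn]; simp

theorem recB_succ (n : ℕ) : recB μ (n + 1) =
    polyInner μ (X * monicOP μ n) (monicOP μ n) / polyInner μ (monicOP μ n) (monicOP μ n) := by
  rw [recB, Nat.add_sub_cancel, orthonormalP, mul_left_comm, polyInner_C_mul_left h,
    polyInner_C_mul_right h, ← sq_polyNorm_monicOP h]
  have := (polyNorm_monicOP_pos h n).ne'
  field_simp

/-- The three-term recurrence for the orthonormal polynomials. -/
theorem recA_mul_eval_orthonormalP (n : ℕ) (x : ℝ) :
    recA μ (n + 2) * (orthonormalP μ (n + 2)).eval x =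
      (x - recB μ (n + 2)) * (orthonormalP μ (n + 1)).eval x -
        recA μ (n + 1) * (orthonormalP μ n).eval x := by
  have hrec := congrArg (eval x) (X_mul_monicOP h n)
  rw [← recB_succ h (n + 1), ← sq_polyNorm_monicOP h, ← sq_polyNorm_monicOP h] at hrec
  simp only [eval_mul, eval_add, eval_X, eval_C] at hrec
  simp only [recA, orthonormalP, eval_mul, eval_C, Nat.add_sub_cancel,
    show n + 2 - 1 = n + 1 by omega]
  have h0 := (polyNorm_monicOP_pos h n).ne'
  have h1 := (polyNorm_monicOP_pos h (n + 1)).ne'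
  have h2 := (polyNorm_monicOP_pos h (n + 2)).ne'
  field_simp at hrec ⊢
  linear_combination -hrec

theorem recA_mul_eval_orthonormalP_one (x : ℝ) :
    recA μ 1 * (orthonormalP μ 1).eval x =
      (x - recB μ 1) * (orthonormalP μ 0).eval x := by
  have hrec := congrArg (eval x) (X_mul_monicOP_zero h)
  rw [← recB_succ h 0] at hrec
  simp only [eval_mul, eval_add, eval_X, eval_C, zero_add] at hrec
  simp only [recA, orthonormalP, eval_mul, eval_C, Nat.sub_self]
  have h0 := (polyNorm_monicOP_pos h 0).ne'
  have h1 := (polyNorm_monicOP_pos h 1).ne'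
  field_simp
  linear_combination -hrec

end

/-! ### Atoms and square summability of `p_n(x₀)`. -/

/-- The Christoffel–Darboux kernel `∑_{k ≤ n} p_k(x₀) p_k` as a polynomial. -/
def cdKernel (μ : Measure ℝ) (x₀ : ℝ) (n : ℕ) : ℝ[X] :=
  ∑ k ∈ Finset.range (n + 1), C ((orthonormalP μ k).eval x₀) * orthonormalP μ k

theorem eval_cdKernel (x₀ x : ℝ) (n : ℕ) : (cdKernel μ x₀ n).eval x =
    ∑ k ∈ Finset.range (n + 1), (orthonormalP μ k).eval x₀ * (orthonormalP μ k).eval x := by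
  simp [cdKernel, eval_finsetSum]

section

variable (h : IsNontrivialMomentMeasure μ)
include h

theorem polyInner_cdKernel_orthonormalP (x₀ : ℝ) {m n : ℕ} (hm : m ≤ n) :
    polyInner μ (cdKernel μ x₀ n) (orthonormalP μ m) = (orthonormalP μ m).eval x₀ := by
  rw [cdKernel, polyInner_sum_left h]
  simp only [polyInner_C_mul_left h, polyInner_orthonormalP h, mul_ite, mul_one, mul_zero]
  rw [Finset.sum_ite_eq' , if_pos (Finset.mem_range.2 (by omega))]

theorem polyInner_cdKernel_self (x₀ : ℝ) (n : ℕ) :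
    polyInner μ (cdKernel μ x₀ n) (cdKernel μ x₀ n) =
      ∑ k ∈ Finset.range (n + 1), (orthonormalP μ k).eval x₀ ^ 2 := by
  conv_lhs => arg 3; rw [cdKernel]
  rw [polyInner_sum_right h]
  refine Finset.sum_congr rfl fun k hk => ?_
  rw [polyInner_C_mul_right h,
    polyInner_cdKernel_orthonormalP h x₀ (Nat.lt_succ_iff.1 (Finset.mem_range.1 hk)), sq]

/-- The Christoffel–Darboux formula. -/
theorem sub_mul_eval_cdKernel (x₀ x : ℝ) (n : ℕ) :
    (x - x₀) * (cdKernel μ x₀ n).eval x = recA μ (n + 1) *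
      ((orthonormalP μ n).eval x₀ * (orthonormalP μ (n + 1)).eval x -
        (orthonormalP μ (n + 1)).eval x₀ * (orthonormalP μ n).eval x) := by
  rw [eval_cdKernel]
  induction n with
  | zero =>
    have h1 := recA_mul_eval_orthonormalP_one h x
    have h2 := recA_mul_eval_orthonormalP_one h x₀
    simp only [zero_add, Finset.sum_range_one]
    linear_combination (orthonormalP μ 0).eval x * h2 - (orthonormalP μ 0).eval x₀ * h1
  | succ n ih =>
    rw [Finset.sum_range_succ, mul_add, ih]
    have h1 := recA_mul_eval_orthonormalP h n x
    have h2 := recA_mul_eval_orthonormalP h n x₀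
    linear_combination (orthonormalP μ (n + 1)).eval x * h2 -
      (orthonormalP μ (n + 1)).eval x₀ * h1

/-- By Christoffel–Darboux the integrand is the square of a combination of just two orthonormal
polynomials. The value tends to 0 when `p_n(x₀) → 0` with `a_n` bounded: the kernel concentrates at
`x₀`. -/
theorem integral_sq_sub_mul_cdKernel (x₀ : ℝ) (n : ℕ) :
    ∫ x, ((x - x₀) * (cdKernel μ x₀ n).eval x) ^ 2 ∂μ = recA μ (n + 1) ^ 2 *
      ((orthonormalP μ n).eval x₀ ^ 2 + (orthonormalP μ (n + 1)).eval x₀ ^ 2) := by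
  set u := (orthonormalP μ n).eval x₀
  set v := (orthonormalP μ (n + 1)).eval x₀
  set f := C u * orthonormalP μ (n + 1) - C v * orthonormalP μ n with hf
  have h1 : ∀ x, ((x - x₀) * (cdKernel μ x₀ n).eval x) ^ 2 =
      recA μ (n + 1) ^ 2 * (f.eval x * f.eval x) := fun x => by
    rw [sub_mul_eval_cdKernel h]
    simp only [hf, eval_sub, eval_mul, eval_C]
    ring
  simp only [h1]
  rw [integral_const_mul]
  congr 1
  change polyInner μ f f = _
  simp only [hf, polyInner_sub_left h, polyInner_sub_right h, polyInner_C_mul_left h,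
    polyInner_C_mul_right h, polyInner_orthonormalP h]
  simp
  ring

/-- The reproducing property tested against the nonzero constant `p_0`. -/
theorem integral_cdKernel (x₀ : ℝ) (n : ℕ) : ∫ x, (cdKernel μ x₀ n).eval x ∂μ = 1 := by
  have hm : monicOP μ 0 = 1 := by rw [monicOP]; simp
  have hc : 0 < (polyNorm μ (monicOP μ 0))⁻¹ := inv_pos.2 (polyNorm_monicOP_pos h 0)
  have h1 := polyInner_cdKernel_orthonormalP h x₀ (Nat.zero_le n)
  have h2 : ∀ x, (orthonormalP μ 0).eval x = (polyNorm μ (monicOP μ 0))⁻¹ := fun x => by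
    simp [orthonormalP, hm]
  simp only [polyInner, h2] at h1
  rw [integral_mul_const] at h1
  exact mul_right_cancel₀ hc.ne' (h1.trans (one_mul _).symm)

/-- If `x₀` is an atom, then the orthonormal polynomials are square summable at `x₀`. -/
theorem summable_sq_of_atom {x₀ : ℝ} (hx : 0 < μ {x₀}) :
    Summable fun n => (orthonormalP μ n).eval x₀ ^ 2 := by
  have := h.isFiniteMeasure
  have hpos : 0 < μ.real {x₀} := ENNReal.toReal_pos hx.ne' (measure_ne_top _ _)
  refine summable_of_sum_range_le (c := 1 / μ.real {x₀}) (fun _ => sq_nonneg _) fun n => ?_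
  refine (Finset.sum_le_sum_of_subset_of_nonneg (Finset.range_subset_range.2 (Nat.le_succ n))
    fun _ _ _ => sq_nonneg _).trans ?_
  set K := ∑ k ∈ Finset.range (n + 1), (orthonormalP μ k).eval x₀ ^ 2 with hK
  have hKe : (cdKernel μ x₀ n).eval x₀ = K := by rw [eval_cdKernel]; simp only [hK, sq]
  -- The left side is `K² μ({x₀})`, which gives `K ≤ 1 / μ({x₀})`.
  have h1 : ∫ x in {x₀}, (cdKernel μ x₀ n).eval x * (cdKernel μ x₀ n).eval x ∂μ ≤ K := by
    rw [hK, ← polyInner_cdKernel_self h]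
    exact setIntegral_le_integral (h.integrable_eval_mul _ _)
      (ae_of_all _ fun x => mul_self_nonneg _)
  rw [integral_singleton, hKe, smul_eq_mul] at h1
  have hK0 : 0 ≤ K := Finset.sum_nonneg fun _ _ => sq_nonneg _
  rw [le_div_iff₀ hpos]
  rcases hK0.eq_or_lt with h0 | h0
  · rw [← h0]; simp
  · refine le_of_mul_le_mul_right ?_ h0
    linarith

/-- If the orthonormal polynomials are square summable at `x₀` and the `a_n` are bounded, then
`x₀` is an atom. -/
theorem atom_of_summable_sq {x₀ a : ℝ} (ha : Tendsto (recA μ) atTop (𝓝 a))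
    (hs : Summable fun n => (orthonormalP μ n).eval x₀ ^ 2) : 0 < μ {x₀} := by
  have := h.isFiniteMeasure
  by_contra hcon
  have h0 : μ {x₀} = 0 := by simpa using hcon
  set S := ∑' n, (orthonormalP μ n).eval x₀ ^ 2
  have hS0 : 0 ≤ S := tsum_nonneg fun _ => sq_nonneg _
  -- The constants are tuned so that the four terms bounding `1 = ∫ K_n` are each below `1/4`: `η`
  -- is small against `S`, `U` has measure below `η/2`, `K` is large against `δ` and the total mass,
  -- and `n` comes last.
  obtain ⟨η, hη, hηS⟩ : ∃ η : ℝ, 0 < η ∧ η / 2 * S < 1 / 4 :=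
    ⟨1 / (2 * (S + 1)), by positivity, by
      rw [div_div, div_mul_eq_mul_div, div_lt_div_iff₀ (by positivity) (by norm_num)]; linarith⟩
  obtain ⟨U, hxU, hUo, hU⟩ := Set.exists_isOpen_lt_of_lt {x₀} (ENNReal.ofReal (η / 2))
    (by rw [h0]; exact ENNReal.ofReal_pos.2 (by positivity))
  obtain ⟨δ, hδ, hball⟩ := Metric.isOpen_iff.1 hUo x₀ (hxU rfl)
  have hUr : μ.real U < η / 2 := by
    rw [Measure.real]
    exact (ENNReal.toReal_lt_of_lt_ofReal hU)
  set m := μ.real Set.univ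
  have hm0 : 0 ≤ m := measureReal_nonneg
  obtain ⟨K, hK, hKm⟩ : ∃ K : ℝ, 0 < K ∧ 1 / (2 * K * δ ^ 2) * m < 1 / 4 := by
    refine ⟨2 * (m + 1) / δ ^ 2, by positivity, ?_⟩
    have : 2 * (2 * (m + 1) / δ ^ 2) * δ ^ 2 = 4 * (m + 1) := by field_simp; ring
    rw [this, div_mul_eq_mul_div, div_lt_div_iff₀ (by positivity) (by norm_num)]; linarith
  have hlim : Tendsto (fun n => K / 2 * ∫ x, ((x - x₀) * (cdKernel μ x₀ n).eval x) ^ 2 ∂μ)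
      atTop (𝓝 0) := by
    simp only [integral_sq_sub_mul_cdKernel h]
    have hp := hs.tendsto_atTop_zero
    have hp1 := (tendsto_add_atTop_iff_nat 1).2 hp
    have ha1 := ((tendsto_add_atTop_iff_nat 1).2 ha).pow 2
    simpa using (ha1.mul (hp.add hp1)).const_mul (K / 2)
  obtain ⟨n, hn⟩ := (hlim.eventually (gt_mem_nhds (show (0 : ℝ) < 1 / 4 by norm_num))).exists
  set s : ℝ → ℝ := fun x => (cdKernel μ x₀ n).eval x with hs_def
  -- Weighted AM–GM: on `U` it is applied to `s · 1` with weight `η`, and off `U` to `(δ s) · δ⁻¹`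
  -- with weight `K`, using `|x - x₀| ≥ δ`.
  have hpt : ∀ x, s x ≤ η / 2 * (s x * s x) + (1 / (2 * η)) * U.indicator 1 x +
      K / 2 * ((x - x₀) * s x) ^ 2 + 1 / (2 * K * δ ^ 2) := by
    intro x
    by_cases hx : x ∈ U
    · rw [Set.indicator_of_mem hx, Pi.one_apply, mul_one]
      have h1 : η / 2 * (s x * s x) + 1 / (2 * η) - s x = (η * s x - 1) ^ 2 / (2 * η) := by
        field_simp; ring
      have h2 : 0 ≤ (η * s x - 1) ^ 2 / (2 * η) := by positivity
      have h3 : 0 ≤ K / 2 * ((x - x₀) * s x) ^ 2 + 1 / (2 * K * δ ^ 2) := by positivity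
      linarith
    · rw [Set.indicator_of_notMem hx, mul_zero, add_zero]
      have hd : δ ≤ |x - x₀| := by
        by_contra hlt
        exact hx (hball (by rw [Metric.mem_ball, Real.dist_eq]; exact not_le.1 hlt))
      have hd2 : δ ^ 2 ≤ (x - x₀) ^ 2 := by
        rw [← sq_abs (x - x₀)]; gcongr
      have h1 : K / 2 * (δ * s x) ^ 2 + 1 / (2 * K * δ ^ 2) - s x =
          (K * δ ^ 2 * s x - 1) ^ 2 / (2 * K * δ ^ 2) := by
        field_simp; ring
      have h2 : 0 ≤ (K * δ ^ 2 * s x - 1) ^ 2 / (2 * K * δ ^ 2) := by positivity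
      have h3 : K / 2 * (δ * s x) ^ 2 ≤ K / 2 * ((x - x₀) * s x) ^ 2 := by
        rw [mul_pow, mul_pow]; gcongr
      have h4 : 0 ≤ η / 2 * (s x * s x) := by have := mul_self_nonneg (s x); positivity
      linarith
  have i1 : Integrable (fun x => η / 2 * (s x * s x)) μ := (h.integrable_eval_mul _ _).const_mul _
  have i2 : Integrable (fun x => (1 / (2 * η)) * U.indicator (1 : ℝ → ℝ) x) μ :=
    ((integrable_const (1 : ℝ)).indicator hUo.measurableSet).const_mul _
  have i3 : Integrable (fun x => K / 2 * ((x - x₀) * s x) ^ 2) μ := by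
    refine Integrable.const_mul ?_ _
    refine (h.integrable_eval (((X - C x₀) * cdKernel μ x₀ n) ^ 2)).congr (ae_of_all _ fun x => ?_)
    simp [hs_def, eval_pow]
  have i4 : Integrable (fun _ : ℝ => 1 / (2 * K * δ ^ 2)) μ := integrable_const _
  have hint := integral_mono (h.integrable_eval (cdKernel μ x₀ n))
    (((i1.add i2).add i3).add i4) hpt
  rw [integral_cdKernel h, integral_add' ((i1.add i2).add i3) i4, integral_add' (i1.add i2) i3,
    integral_add' i1 i2, integral_const_mul, integral_const_mul, integral_indicator_one
    hUo.measurableSet, integral_const_mul, integral_const, smul_eq_mul] at hint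
  have e1 : ∫ x, s x * s x ∂μ ≤ S := by
    have := polyInner_cdKernel_self h x₀ n
    rw [polyInner] at this
    rw [this]
    exact hs.sum_le_tsum _ fun _ _ => sq_nonneg _
  have e1' : η / 2 * ∫ x, s x * s x ∂μ ≤ η / 2 * S := by gcongr
  have e2 : 1 / (2 * η) * μ.real U < 1 / 4 := by
    rw [div_mul_eq_mul_div, div_lt_div_iff₀ (by positivity) (by norm_num)]; linarith
  have e4 : μ.real Set.univ * (1 / (2 * K * δ ^ 2)) < 1 / 4 := by rw [mul_comm]; exact hKm
  linarith

end

/-! ### Perturbed contractions and tail variation. -/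

/-- Summing the inequality and absorbing `ρ` times the partial sum on the left bounds all partial
sums. -/
theorem summable_of_abs_le_mul_add {u v : ℕ → ℝ} {ρ : ℝ} (hρ : ρ < 1)
    (hu : ∀ n, 0 ≤ u n) (hv : ∀ n, 0 ≤ v n)
    (hsum : Summable v) (hrec : ∀ n, u (n + 1) ≤ ρ * u n + v n) : Summable u := by
  refine summable_of_sum_range_le (c := (u 0 + ∑' n, v n) / (1 - ρ)) hu fun n => ?_
  rw [le_div_iff₀ (by linarith)]
  have h1 : ∑ i ∈ Finset.range n, u (i + 1) ≤
      ρ * ∑ i ∈ Finset.range n, u i + ∑ i ∈ Finset.range n, v i := by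
    rw [Finset.mul_sum, ← Finset.sum_add_distrib]
    exact Finset.sum_le_sum fun i _ => hrec i
  have h2 := hsum.sum_le_tsum (Finset.range n) fun i _ => hv i
  have h3 := Finset.sum_range_succ u n
  rw [Finset.sum_range_succ'] at h3
  have h4 := hu n
  linarith

/-- A sequence satisfying `u (n + 1) ≤ (1 + e n) * u n` with `e` summable is bounded. -/
theorem exists_bound_of_le_one_add_mul {u e : ℕ → ℝ} (he : ∀ n, 0 ≤ e n) (hsum : Summable e)
    (hu : ∀ n, 0 ≤ u n) (hrec : ∀ n, u (n + 1) ≤ (1 + e n) * u n) :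
    ∃ M, ∀ n, u n ≤ M := by
  have hexp : ∀ n, u n ≤ u 0 * Real.exp (∑ i ∈ Finset.range n, e i) := by
    intro n
    induction n with
    | zero => simp
    | succ n ih =>
      rw [Finset.sum_range_succ, Real.exp_add]
      have h1 : 1 + e n ≤ Real.exp (e n) := by linarith [Real.add_one_le_exp (e n)]
      calc u (n + 1) ≤ (1 + e n) * u n := hrec n
        _ ≤ Real.exp (e n) * (u 0 * Real.exp (∑ i ∈ Finset.range n, e i)) :=
            mul_le_mul h1 ih (hu n) (Real.exp_pos _).le
        _ = _ := by ring
  refine ⟨u 0 * Real.exp (∑' i, e i), fun n => (hexp n).trans ?_⟩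
  exact mul_le_mul_of_nonneg_left (Real.exp_le_exp.2 (hsum.sum_le_tsum _ fun i _ => he i)) (hu 0)

/-- If the increments of `k` satisfy a contracting recurrence with a summable perturbation, then
`k` is of bounded variation. -/
theorem summable_abs_increments {k r e : ℕ → ℝ} {ρ : ℝ} (hρ : ρ < 1)
    (hr : ∀ n, |r n| ≤ ρ) (he : Summable fun n => |e n|)
    (hrec : ∀ n, k (n + 2) - k (n + 1) = r n * (k (n + 1) - k n) + e n * k n) :
    Summable fun n => |k (n + 1) - k n| := by
  have hstep : ∀ n, |k (n + 2) - k (n + 1)| ≤ ρ * |k (n + 1) - k n| + |e n| * |k n| := by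
    intro n
    rw [hrec n]
    refine (abs_add_le _ _).trans ?_
    rw [abs_mul, abs_mul]
    gcongr
    exact hr n
  -- This weight solves `1 + c ρ = c`, so `|k n| + c |k (n+1) - k n|` grows by a factor of at most
  -- `1 + c |e n|` per step and stays bounded.
  set c : ℝ := 1 / (1 - ρ) with hc
  have hc0 : 0 < c := by rw [hc]; exact one_div_pos.2 (by linarith)
  have hcρ : 1 + c * ρ = c := by
    have : 1 - ρ ≠ 0 := by linarith
    rw [hc]; field_simp; ring
  obtain ⟨M, hM⟩ := exists_bound_of_le_one_add_mul
    (u := fun n => |k n| + c * |k (n + 1) - k n|) (e := fun n => c * |e n|)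
    (fun n => by positivity) (he.mul_left c) (fun n => by positivity) (fun n => by
      have h1 : |k (n + 1)| ≤ |k n| + |k (n + 1) - k n| := by
        have := abs_add_le (k n) (k (n + 1) - k n)
        rwa [add_sub_cancel] at this
      have h2 := mul_le_mul_of_nonneg_left (hstep n) hc0.le
      have h3 : 0 ≤ c * |e n| * (c * |k (n + 1) - k n|) := by positivity
      have h4 : |k (n + 1) - k n| + c * ρ * |k (n + 1) - k n| = c * |k (n + 1) - k n| := by
        rw [← one_add_mul, hcρ]
      nlinarith)
  have hkM : ∀ n, |k n| ≤ M := fun n =>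
    (le_add_of_nonneg_right (by positivity)).trans (hM n)
  refine summable_of_abs_le_mul_add (v := fun n => |e n| * M) hρ (fun _ => abs_nonneg _)
    (fun n => mul_nonneg (abs_nonneg _) ((abs_nonneg _).trans (hkM n))) (he.mul_right M)
    fun n => (hstep n).trans ?_
  have := mul_le_mul_of_nonneg_left (hkM n) (abs_nonneg (e n))
  linarith

theorem summable_abs_increments_of_eventually {k r e : ℕ → ℝ} {ρ : ℝ} (hρ : ρ < 1)
    (hr : ∀ᶠ n in atTop, |r n| ≤ ρ) (he : Summable fun n => |e n|)
    (hrec : ∀ᶠ n in atTop,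
      k (n + 2) - k (n + 1) = r n * (k (n + 1) - k n) + e n * k n) :
    Summable fun n => |k (n + 1) - k n| := by
  obtain ⟨m, hm⟩ := eventually_atTop.1 (hr.and hrec)
  rw [← summable_nat_add_iff m]
  have := summable_abs_increments (k := fun n => k (n + m)) (r := fun n => r (n + m))
    (e := fun n => e (n + m)) hρ (fun n => (hm (n + m) (by omega)).1)
    ((summable_nat_add_iff m).2 he) (fun n => by
      have := (hm (n + m) (by omega)).2
      convert this using 3 <;> ring_nf)
  refine this.congr fun n => ?_
  rw [show n + 1 + m = n + m + 1 by ring]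

/-- The tail variation `∑_{m ≥ n} |k (m + 1) - k m|`. -/
def tailVar (k : ℕ → ℝ) (n : ℕ) : ℝ := ∑' m, |k (m + n + 1) - k (m + n)|

theorem tailVar_nonneg (k : ℕ → ℝ) (n : ℕ) : 0 ≤ tailVar k n := tsum_nonneg fun _ => abs_nonneg _

theorem IsBV.summable_add {k : ℕ → ℝ} (hk : IsBV k) (n : ℕ) :
    Summable fun m => |k (m + n + 1) - k (m + n)| :=
  (summable_nat_add_iff (f := fun m => |k (m + 1) - k m|) n).2 hk

theorem IsBV.tailVar_eq {k : ℕ → ℝ} (hk : IsBV k) (n : ℕ) :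
    tailVar k n = |k (n + 1) - k n| + tailVar k (n + 1) := by
  rw [tailVar, (hk.summable_add n).tsum_eq_zero_add, tailVar]
  simp only [zero_add]
  congr 1
  refine tsum_congr fun m => ?_
  rw [show m + 1 + n = m + (n + 1) by ring]

theorem IsBV.tailVar_antitone {k : ℕ → ℝ} (hk : IsBV k) : Antitone (tailVar k) :=
  antitone_nat_of_succ_le fun n => by
    rw [hk.tailVar_eq n]; linarith [abs_nonneg (k (n + 1) - k n)]

theorem IsBV.exists_tendsto {k : ℕ → ℝ} (hk : IsBV k) : ∃ l, Tendsto k atTop (𝓝 l) := by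
  have hs : Summable fun n => k (n + 1) - k n := hk.of_abs
  have := hs.hasSum.tendsto_sum_nat
  simp only [Finset.sum_range_sub] at this
  exact ⟨_, (this.add_const (k 0)).congr fun n => by ring⟩

theorem IsBV.abs_le_tailVar {k : ℕ → ℝ} (hk : IsBV k) (h0 : Tendsto k atTop (𝓝 0)) (n : ℕ) :
    |k n| ≤ tailVar k n := by
  have hb : ∀ m, |k (m + n) - k n| ≤ tailVar k n := by
    intro m
    have : k (m + n) - k n = ∑ i ∈ Finset.range m, (k (i + n + 1) - k (i + n)) := by
      have := Finset.sum_range_sub (fun i => k (i + n)) m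
      simp only [zero_add] at this
      rw [← this]
      refine Finset.sum_congr rfl fun i _ => ?_
      rw [show i + 1 + n = i + n + 1 by ring]
    rw [this]
    exact (Finset.abs_sum_le_sum_abs _ _).trans
      ((hk.summable_add n).sum_le_tsum _ fun _ _ => abs_nonneg _)
  have hlim : Tendsto (fun m => |k (m + n) - k n|) atTop (𝓝 |0 - k n|) :=
    (((tendsto_add_atTop_iff_nat n).2 h0).sub_const _).abs
  simpa using le_of_tendsto' hlim hb

/-- If in addition `k` tends to zero, the tail variation contracts at any rate above the
contraction rate of the recurrence. -/
theorem IsBV.eventually_tailVar_le {k r e : ℕ → ℝ} {ρ ρ' : ℝ} (hρρ' : ρ < ρ') (hk : IsBV k)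
    (h0 : Tendsto k atTop (𝓝 0))
    (hr : ∀ᶠ n in atTop, |r n| ≤ ρ) (he : Summable fun n => |e n|)
    (hrec : ∀ᶠ n in atTop,
      k (n + 2) - k (n + 1) = r n * (k (n + 1) - k n) + e n * k n) :
    ∀ᶠ n in atTop, tailVar k (n + 1) ≤ ρ' * tailVar k n := by
  have htail : Tendsto (fun n => ∑' m, |e (m + n)|) atTop (𝓝 0) :=
    tendsto_sum_nat_add fun m => |e m|
  obtain ⟨m, hm⟩ := eventually_atTop.1 ((hr.and hrec).and
    (htail.eventually (gt_mem_nhds (sub_pos.2 hρρ'))))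
  filter_upwards [eventually_ge_atTop m] with n hn
  have hen : Summable fun i => |e (i + n)| :=
    (summable_nat_add_iff (f := fun i => |e i|) n).2 he
  -- Since `k → 0`, `|k (i + n)|` is at most `tailVar k n`. The error thus costs the tail sum of
  -- `|e|` times `tailVar k n`, and that tail sum is already below `ρ' - ρ`.
  have hle : tailVar k (n + 1) ≤ ∑' i,
      (ρ * |k (i + n + 1) - k (i + n)| + |e (i + n)| * tailVar k n) := by
    refine (hk.summable_add (n + 1)).tsum_le_tsum (fun i => ?_)
      (((hk.summable_add n).mul_left ρ).add (hen.mul_right _))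
    have h1 := (hm (i + n) (by omega)).1
    rw [show i + (n + 1) + 1 = i + n + 2 by ring, show i + (n + 1) = i + n + 1 by ring, h1.2]
    refine (abs_add_le _ _).trans ?_
    rw [abs_mul, abs_mul]
    gcongr
    · exact h1.1
    · exact (hk.abs_le_tailVar h0 _).trans (hk.tailVar_antitone (by omega))
  rw [((hk.summable_add n).mul_left ρ).tsum_add (hen.mul_right _), tsum_mul_left,
    tsum_mul_right] at hle
  have h2 := mul_le_mul_of_nonneg_right (hm n hn).2.le (tailVar_nonneg k n)
  have h3 : ∑' i, |k (i + n + 1) - k (i + n)| = tailVar k n := rfl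
  rw [h3] at hle
  linarith

theorem exists_le_mul_pow_of_eventually {G : ℕ → ℝ} {q : ℝ} (hq : 0 < q)
    (hG : ∀ᶠ n in atTop, G (n + 1) ≤ q * G n) : ∃ c, ∀ n, G n ≤ c * q ^ n := by
  obtain ⟨m, hm⟩ := eventually_atTop.1 hG
  have hdecr : ∀ n, G (n + m) ≤ (G m / q ^ m) * q ^ (n + m) := by
    intro n
    induction n with
    | zero => rw [zero_add, div_mul_cancel₀ _ (pow_pos hq m).ne']
    | succ n ih =>
      rw [show n + 1 + m = n + m + 1 by ring, pow_succ]
      have := (hm (n + m) (by omega)).trans (mul_le_mul_of_nonneg_left ih hq.le)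
      linarith
  refine ⟨|G m / q ^ m| + ∑ i ∈ Finset.range m, |G i / q ^ i|, fun n => ?_⟩
  have hqn := pow_pos hq n
  have hs : 0 ≤ ∑ i ∈ Finset.range m, |G i / q ^ i| := Finset.sum_nonneg fun _ _ => abs_nonneg _
  rcases lt_or_ge n m with hlt | hge
  · have h1 : |G n / q ^ n| ≤ ∑ i ∈ Finset.range m, |G i / q ^ i| :=
      Finset.single_le_sum (f := fun i => |G i / q ^ i|) (fun _ _ => abs_nonneg _)
        (Finset.mem_range.2 hlt)
    rw [← div_le_iff₀ hqn]
    linarith [le_abs_self (G n / q ^ n), abs_nonneg (G m / q ^ m)]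
  · obtain ⟨i, rfl⟩ := Nat.exists_eq_add_of_le' hge
    refine (hdecr i).trans (mul_le_mul_of_nonneg_right ?_ hqn.le)
    linarith [le_abs_self (G m / q ^ m)]

/-! ### Eigenvalues of the one-step matrix. -/

theorem hasEigenvalue_stepMatrix_iff {α : ℝ} (hα : α ≠ 0) (β x z : ℝ) :
    Module.End.HasEigenvalue (Matrix.toLin' (stepMatrix α β x)) z ↔
      z ^ 2 - (x - β) / α * z + 1 = 0 := by
  rw [Module.End.hasEigenvalue_iff_isRoot_charpoly, Matrix.charpoly_toLin',
    Matrix.charpoly_fin_two, IsRoot.def]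
  have htr : (stepMatrix α β x).trace = (x - β) / α := by
    simp [stepMatrix, Matrix.trace_fin_two]; ring
  have hdet : (stepMatrix α β x).det = 1 := by
    simp [stepMatrix, Matrix.det_fin_two]; field_simp
  rw [htr, hdet]
  simp

/-- Comes from `t = w + w⁻¹`. It yields uniqueness, convergence and bounded variation of the
contracting root from those of `t`, with no square-root formula to differentiate. -/
theorem sub_mul_mul_sub_one {w w' t t' : ℝ} (hw : w ^ 2 - t * w + 1 = 0)
    (hw' : w' ^ 2 - t' * w' + 1 = 0) : (w - w') * (w * w' - 1) = (t - t') * (w * w') := by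
  linear_combination w' * hw - w * hw'

theorem ne_zero_of_root {w t : ℝ} (hw : w ^ 2 - t * w + 1 = 0) : w ≠ 0 := by
  rintro rfl; norm_num at hw

theorem inv_root {w t : ℝ} (hw : w ^ 2 - t * w + 1 = 0) : w⁻¹ ^ 2 - t * w⁻¹ + 1 = 0 := by
  have := ne_zero_of_root hw
  field_simp
  linear_combination hw

theorem abs_sub_mul_le {w w' t t' : ℝ} (hw : w ^ 2 - t * w + 1 = 0)
    (hw' : w' ^ 2 - t' * w' + 1 = 0) (h1 : |w| ≤ 1) (h1' : |w'| ≤ 1) :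
    |w - w'| * (1 - |w| * |w'|) ≤ |t - t'| := by
  have h := congrArg abs (sub_mul_mul_sub_one hw hw')
  rw [abs_mul, abs_mul, abs_mul] at h
  have h2 : 1 - |w| * |w'| ≤ |w * w' - 1| := by
    rw [← abs_mul, abs_sub_comm]
    have := abs_sub_abs_le_abs_sub 1 (w * w')
    rwa [abs_one] at this
  have h3 : |w| * |w'| ≤ 1 := mul_le_one₀ h1 (abs_nonneg _) h1'
  calc |w - w'| * (1 - |w| * |w'|) ≤ |w - w'| * |w * w' - 1| := by gcongr
    _ = |t - t'| * (|w| * |w'|) := h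
    _ ≤ |t - t'| := mul_le_of_le_one_right (abs_nonneg _) h3

theorem exists_contracting_root {t : ℝ} (ht : 2 < |t|) :
    ∃ w : ℝ, w ^ 2 - t * w + 1 = 0 ∧ |w| < 1 := by
  have h4 : 0 ≤ t ^ 2 - 4 := by
    have := sq_abs t
    nlinarith
  set s := Real.sqrt (t ^ 2 - 4)
  have hs : s ^ 2 = t ^ 2 - 4 := Real.sq_sqrt h4
  have hz : ((t + s) / 2) ^ 2 - t * ((t + s) / 2) + 1 = 0 := by linear_combination hs / 4
  set z := (t + s) / 2
  rcases lt_trichotomy |z| 1 with h | h | h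
  · exact ⟨z, hz, h⟩
  · exfalso
    rcases (abs_eq zero_le_one).1 h with h | h <;> rw [h] at hz
    · have : t = 2 := by linarith
      rw [this] at ht; norm_num at ht
    · have : t = -2 := by linarith
      rw [this] at ht; norm_num at ht
  · exact ⟨z⁻¹, inv_root hz, by rw [abs_inv]; exact inv_lt_one_of_one_lt₀ h⟩

theorem contracting_root_unique {t w w' : ℝ} (hw : w ^ 2 - t * w + 1 = 0)
    (hw' : w' ^ 2 - t * w' + 1 = 0) (h1 : |w| < 1) (h1' : |w'| < 1) : w = w' := by
  have h := abs_sub_mul_le hw hw' h1.le h1'.le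
  have h2 : |w| * |w'| < 1 := mul_lt_one_of_nonneg_of_lt_one_left (abs_nonneg _) h1 h1'.le
  rw [sub_self, abs_zero] at h
  have h3 : |w - w'| ≤ 0 := by
    by_contra hc
    have := mul_pos (not_le.1 hc) (sub_pos.2 h2)
    linarith
  exact sub_eq_zero.1 (abs_nonpos_iff.1 h3)

theorem existsUnique_isContractingEigenvalue {α β x : ℝ} (hα : α ≠ 0)
    (ht : 2 < |(x - β) / α|) : ∃! z, IsContractingEigenvalue (stepMatrix α β x) z := by
  simp only [IsContractingEigenvalue, hasEigenvalue_stepMatrix_iff hα]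
  obtain ⟨w, hw⟩ := exists_contracting_root ht
  exact ⟨w, hw, fun z hz => contracting_root_unique hz.1 hw.1 hz.2 hw.2⟩

theorem existsUnique_isExpandingEigenvalue {α β x : ℝ} (hα : α ≠ 0)
    (ht : 2 < |(x - β) / α|) : ∃! z, IsExpandingEigenvalue (stepMatrix α β x) z := by
  simp only [IsExpandingEigenvalue, hasEigenvalue_stepMatrix_iff hα]
  obtain ⟨w, hw, hw1⟩ := exists_contracting_root ht
  have hw0 := ne_zero_of_root hw
  refine ⟨w⁻¹, ⟨inv_root hw, ?_⟩, fun z hz => ?_⟩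
  · rw [abs_inv]
    exact one_lt_inv_iff₀.2 ⟨abs_pos.2 hw0, hw1⟩
  · rw [← inv_inv z]
    congr 1
    refine contracting_root_unique (inv_root hz.1) hw ?_ hw1
    rw [abs_inv]
    exact inv_lt_one_of_one_lt₀ hz.2

/-! ### Asymptotics of solutions of the scalar recurrence. -/

section Asymptotics

variable {t v : ℕ → ℝ} {τ w : ℝ} {N : ℕ}

theorem tendsto_contracting_root (ht : Tendsto t atTop (𝓝 τ)) (hw : w ^ 2 - τ * w + 1 = 0)
    (hw1 : |w| < 1) (hv : ∀ j > N, v j ^ 2 - t j * v j + 1 = 0) (hv1 : ∀ j > N, |v j| < 1) :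
    Tendsto v atTop (𝓝 w) := by
  rw [tendsto_iff_dist_tendsto_zero]
  have h0 : Tendsto (fun j => |t j - τ| / (1 - |w|)) atTop (𝓝 0) := by
    have := ((ht.sub_const τ).abs).div_const (1 - |w|)
    simpa using this
  refine squeeze_zero' (Eventually.of_forall fun _ => dist_nonneg) ?_ h0
  filter_upwards [eventually_gt_atTop N] with j hj
  rw [Real.dist_eq, le_div_iff₀ (by linarith)]
  refine le_trans ?_ (abs_sub_mul_le (hv j hj) hw (hv1 j hj).le hw1.le)
  have := mul_le_of_le_one_left (abs_nonneg w) (hv1 j hj).le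
  gcongr

theorem isBV_contracting_root (htBV : IsBV t) (hvw : Tendsto v atTop (𝓝 w)) (hw1 : |w| < 1)
    (hv : ∀ j > N, v j ^ 2 - t j * v j + 1 = 0) : IsBV v := by
  obtain ⟨ρ, hρ, hρ1⟩ := exists_between hw1
  have hev := hvw.abs.eventually (gt_mem_nhds hρ)
  have hρ0 : 0 ≤ ρ := (abs_nonneg w).trans hρ.le
  have hpos : 0 < 1 - ρ := by linarith
  refine Summable.of_norm_bounded_eventually_nat
    (g := fun n => |t (n + 1) - t n| / (1 - ρ)) (htBV.div_const _) ?_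
  filter_upwards [eventually_gt_atTop N, hev, (tendsto_add_atTop_nat 1).eventually hev]
    with n hn h1 h2
  rw [Real.norm_eq_abs, abs_abs, le_div_iff₀ hpos]
  refine le_trans ?_ (abs_sub_mul_le (hv (n + 1) (by omega)) (hv n hn)
    (h2.le.trans hρ1.le) (h1.le.trans hρ1.le))
  have : |v (n + 1)| * |v n| ≤ ρ := (mul_le_of_le_one_right (abs_nonneg _)
    (h1.le.trans hρ1.le)).trans h2.le
  gcongr

variable {p c lam : ℕ → ℝ}

/-- Substitute `t = λ + λ⁻¹` at index `n + 2` and divide by the product. The coefficient of `k n`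
vanishes when `c = 1` and `λ` is constant, so it measures only the variation of the coefficients. -/
theorem ratio_recurrence (hrec : ∀ n, p (n + 2) = t (n + 2) * p (n + 1) - c n * p n)
    (hlam : ∀ j > N, lam j ^ 2 - t j * lam j + 1 = 0) {n : ℕ} (hn : N ≤ n) {k : ℕ → ℝ}
    (hk : ∀ n, p n = (∏ j ∈ Finset.Ioc N n, lam j) * k n) :
    k (n + 2) - k (n + 1) = (lam (n + 2))⁻¹ ^ 2 * (k (n + 1) - k n) +
      (lam (n + 2))⁻¹ * ((lam (n + 2))⁻¹ - c n * (lam (n + 1))⁻¹) * k n := by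
  have hP : ∏ j ∈ Finset.Ioc N n, lam j ≠ 0 := Finset.prod_ne_zero_iff.2 fun j hj =>
    ne_zero_of_root (hlam j (Finset.mem_Ioc.1 hj).1)
  have hr := hrec n
  rw [hk (n + 2), hk (n + 1), hk n, Finset.prod_Ioc_succ_top (show N ≤ n + 1 by omega),
    Finset.prod_Ioc_succ_top hn] at hr
  have h1 := ne_zero_of_root (hlam (n + 1) (by omega))
  have h2 := ne_zero_of_root (hlam (n + 2) (by omega))
  have hl := hlam (n + 2) (by omega)
  have hr' : lam (n + 1) * lam (n + 2) * k (n + 2) =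
      t (n + 2) * lam (n + 1) * k (n + 1) - c n * k n :=
    mul_left_cancel₀ hP (by linear_combination hr)
  field_simp
  linear_combination lam (n + 2) * hr' - lam (n + 1) * k (n + 1) * hl

theorem summable_perturbation (hc : Summable fun n => |1 - c n|) (hvBV : IsBV v)
    (hv1 : ∀ j > N, |v j| < 1) :
    Summable fun n => |v (n + 2) * (v (n + 2) - c n * v (n + 1))| := by
  refine Summable.of_norm_bounded_eventually_nat
    (g := fun n => |v (n + 1 + 1) - v (n + 1)| + |1 - c n|)
    (((summable_nat_add_iff (f := fun n => |v (n + 1) - v n|) 1).2 hvBV).add hc) ?_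
  filter_upwards [eventually_ge_atTop N] with n hn
  have h1 := (hv1 (n + 1) (by omega)).le
  have h2 := (hv1 (n + 2) (by omega)).le
  rw [Real.norm_eq_abs, abs_abs, abs_mul]
  refine (mul_le_of_le_one_left (abs_nonneg _) h2).trans ?_
  have : v (n + 2) - c n * v (n + 1) = (v (n + 2) - v (n + 1)) + (1 - c n) * v (n + 1) := by ring
  rw [this]
  refine (abs_add_le _ _).trans (add_le_add le_rfl ?_)
  rw [abs_mul]
  exact mul_le_of_le_one_right (abs_nonneg _) h1

/-- The ratio of a solution of the recurrence to the product of the expanding eigenvalues is of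
bounded variation; if it tends to zero, the solution decays at the rate of the contracting
eigenvalue of the limit. -/
theorem ratio_isBV_and_decay (ht : Tendsto t atTop (𝓝 τ)) (htBV : IsBV t)
    (hc : Summable fun n => |1 - c n|) (hw : w ^ 2 - τ * w + 1 = 0) (hw1 : |w| < 1)
    (hrec : ∀ n, p (n + 2) = t (n + 2) * p (n + 1) - c n * p n)
    (hlam : ∀ j > N, lam j ^ 2 - t j * lam j + 1 = 0) (hlam1 : ∀ j > N, 1 < |lam j|)
    {k : ℕ → ℝ} (hk : ∀ n, p n = (∏ j ∈ Finset.Ioc N n, lam j) * k n) :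
    IsBV k ∧ (Tendsto k atTop (𝓝 0) →
      ∀ ε : ℝ, 0 < ε → ∃ C : ℝ, ∀ n, |p n| ≤ C * (|w| + ε) ^ n) := by
  set v : ℕ → ℝ := fun j => (lam j)⁻¹ with hvdef
  have hv : ∀ j > N, v j ^ 2 - t j * v j + 1 = 0 := fun j hj => inv_root (hlam j hj)
  have hv1 : ∀ j > N, |v j| < 1 := fun j hj => by
    rw [hvdef, abs_inv]; exact inv_lt_one_of_one_lt₀ (hlam1 j hj)
  have hvw := tendsto_contracting_root ht hw hw1 hv hv1
  have hvBV := isBV_contracting_root htBV hvw hw1 hv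
  have hrk : ∀ᶠ n in atTop, k (n + 2) - k (n + 1) = v (n + 2) ^ 2 * (k (n + 1) - k n) +
      v (n + 2) * (v (n + 2) - c n * v (n + 1)) * k n := by
    filter_upwards [eventually_ge_atTop N] with n hn
    exact ratio_recurrence hrec hlam hn hk
  have he := summable_perturbation hc hvBV hv1
  have hr : ∀ ρ, w ^ 2 < ρ → ∀ᶠ n in atTop, |v (n + 2) ^ 2| ≤ ρ := fun ρ hρ => by
    have h2 := ((tendsto_add_atTop_iff_nat 2).2 (hvw.pow 2)).eventually (gt_mem_nhds hρ)
    filter_upwards [h2] with n hn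
    rw [abs_of_nonneg (sq_nonneg _)]
    exact hn.le
  have hw2 : w ^ 2 < 1 := (sq_lt_one_iff_abs_lt_one w).2 hw1
  obtain ⟨ρ, hρ, hρ1⟩ := exists_between hw2
  have hkBV : IsBV k := summable_abs_increments_of_eventually hρ1 (hr ρ hρ) he hrk
  refine ⟨hkBV, fun h0 ε hε => ?_⟩
  have hw0 : 0 < |w| := abs_pos.2 (ne_zero_of_root hw)
  -- The rate `w² + |w| ε/2`, multiplied by the growth `|w|⁻¹` of the product, gives `|w| + ε/2`;
  -- this leaves room below `|w| + ε`.
  have htv := hkBV.eventually_tailVar_le (ρ := w ^ 2 + |w| * (ε / 4))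
    (ρ' := w ^ 2 + |w| * (ε / 2)) (by gcongr; norm_num) h0
    (hr _ (lt_add_of_pos_right _ (by positivity))) he hrk
  have hlw : Tendsto (fun n => |lam (n + 1)| * (w ^ 2 + |w| * (ε / 2))) atTop
      (𝓝 (|w⁻¹| * (w ^ 2 + |w| * (ε / 2)))) := by
    refine Tendsto.mul_const _ (Tendsto.abs ?_)
    refine (((tendsto_add_atTop_iff_nat 1).2 hvw).inv₀ (ne_zero_of_root hw)).congr fun n => ?_
    simp [hvdef]
  have hlt : |w⁻¹| * (w ^ 2 + |w| * (ε / 2)) < |w| + ε := by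
    rw [abs_inv, ← sq_abs w]
    have : |w|⁻¹ * (|w| ^ 2 + |w| * (ε / 2)) = |w| + ε / 2 := by field_simp
    linarith
  -- The tail variation replaces `|k n|` because it is the quantity with a one-step contraction.
  obtain ⟨C, hC⟩ := exists_le_mul_pow_of_eventually
    (G := fun n => |∏ j ∈ Finset.Ioc N n, lam j| * tailVar k n) (q := |w| + ε) (by positivity) (by
      filter_upwards [htv, hlw.eventually (gt_mem_nhds hlt), eventually_ge_atTop N] with n h1 h2 hn
      rw [Finset.prod_Ioc_succ_top hn, abs_mul]
      have h3 := tailVar_nonneg k n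
      calc |∏ j ∈ Finset.Ioc N n, lam j| * |lam (n + 1)| * tailVar k (n + 1)
          ≤ |∏ j ∈ Finset.Ioc N n, lam j| * |lam (n + 1)| *
            ((w ^ 2 + |w| * (ε / 2)) * tailVar k n) := by gcongr
        _ = |lam (n + 1)| * (w ^ 2 + |w| * (ε / 2)) *
            (|∏ j ∈ Finset.Ioc N n, lam j| * tailVar k n) := by ring
        _ ≤ _ := by gcongr)
  refine ⟨C, fun n => le_trans ?_ (hC n)⟩
  rw [hk n, abs_mul]
  exact mul_le_mul_of_nonneg_left (hkBV.abs_le_tailVar h0 n) (abs_nonneg _)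

end Asymptotics

/-! ### From the recurrence coefficients to the hypotheses of the scalar recurrence. -/

section Nevai

variable {α β : ℕ → ℝ} {a b x : ℝ}

theorem summable_abs_one_sub_div (hα : ∀ n, 0 < α n) (ha : 0 < a) (hαa : Tendsto α atTop (𝓝 a))
    (hBV : IsBV α) : Summable fun n => |1 - α (n + 1) / α (n + 2)| := by
  refine Summable.of_norm_bounded_eventually_nat
    (g := fun n => |α (n + 1 + 1) - α (n + 1)| / (a / 2))
    (((summable_nat_add_iff (f := fun n => |α (n + 1) - α n|) 1).2 hBV).div_const _) ?_
  filter_upwards [((tendsto_add_atTop_iff_nat 2).2 hαa).eventually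
    (lt_mem_nhds (show a / 2 < a by linarith))] with n hn
  rw [Real.norm_eq_abs, abs_abs]
  have h2 := hα (n + 2)
  have : 1 - α (n + 1) / α (n + 2) = (α (n + 1 + 1) - α (n + 1)) / α (n + 2) := by
    field_simp
  rw [this, abs_div, abs_of_pos h2]
  gcongr

theorem isBV_sub_div (hα : ∀ n, 0 < α n) (ha : 0 < a) (hαa : Tendsto α atTop (𝓝 a))
    (hβb : Tendsto β atTop (𝓝 b)) (hαBV : IsBV α) (hβBV : IsBV β) :
    IsBV fun n => (x - β n) / α n := by
  have ht : Tendsto (fun n => |(x - β n) / α n|) atTop (𝓝 |(x - b) / a|) :=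
    ((hβb.const_sub x).div hαa ha.ne').abs
  set B := |(x - b) / a| + 1
  refine Summable.of_norm_bounded_eventually_nat
    (g := fun n => (|β (n + 1) - β n| + B * |α (n + 1) - α n|) / (a / 2))
    ((hβBV.add (hαBV.mul_left B)).div_const _) ?_
  filter_upwards [((tendsto_add_atTop_iff_nat 1).2 hαa).eventually
    (lt_mem_nhds (show a / 2 < a by linarith)),
    ht.eventually (gt_mem_nhds (lt_add_one _))] with n hn hB
  rw [Real.norm_eq_abs, abs_abs]
  have h1 := hα (n + 1)
  have h0 := hα n
  have : (x - β (n + 1)) / α (n + 1) - (x - β n) / α n =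
      -((β (n + 1) - β n) + (x - β n) / α n * (α (n + 1) - α n)) / α (n + 1) := by
    field_simp; ring
  rw [this, abs_div, abs_of_pos h1, abs_neg]
  gcongr
  refine (abs_add_le _ _).trans ?_
  rw [abs_mul]
  gcongr

end Nevai

theorem two_lt_abs_sub_div {a b x : ℝ} (ha : 0 < a) (hx : x ∉ Set.Icc (b - 2 * a) (b + 2 * a)) :
    2 < |(x - b) / a| := by
  rw [abs_div, abs_of_pos ha, lt_div_iff₀ ha]
  by_contra hc
  have := abs_le.1 (not_lt.1 hc)
  exact hx ⟨by linarith [this.1], by linarith [this.2]⟩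

theorem eval_orthonormalP_recurrence {μ : Measure ℝ} (h : IsNontrivialMomentMeasure μ) (x : ℝ)
    (n : ℕ) : (orthonormalP μ (n + 2)).eval x =
      (x - recB μ (n + 2)) / recA μ (n + 2) * (orthonormalP μ (n + 1)).eval x -
        recA μ (n + 1) / recA μ (n + 2) * (orthonormalP μ n).eval x := by
  have h1 := recA_mul_eval_orthonormalP h n x
  have h2 := (recA_pos h (n + 2)).ne'
  field_simp
  linear_combination h1

theorem summable_sq_of_le_mul_pow {u : ℕ → ℝ} {C q : ℝ} (hq0 : 0 ≤ q) (hq : q < 1)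
    (hu : ∀ n, |u n| ≤ C * q ^ n) : Summable fun n => u n ^ 2 := by
  refine Summable.of_nonneg_of_le (fun _ => sq_nonneg _) (f := fun n => C ^ 2 * (q ^ 2) ^ n)
    (fun n => ?_) ((summable_geometric_of_lt_one (sq_nonneg q) ?_).mul_left _)
  · calc u n ^ 2 = |u n| ^ 2 := (sq_abs _).symm
      _ ≤ (C * q ^ n) ^ 2 := by gcongr; exact hu n
      _ = C ^ 2 * (q ^ 2) ^ n := by ring
  · exact pow_lt_one₀ hq0 hq two_ne_zero

/-- The products have absolute value at least 1, so `p_n² ≥ k_n²`, which does not tend to zero. -/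
theorem not_summable_sq_of_ratio {p lam k : ℕ → ℝ} {N : ℕ} {l : ℝ} (hl : l ≠ 0)
    (hkl : Tendsto k atTop (𝓝 l)) (hlam1 : ∀ j > N, 1 < |lam j|)
    (hk : ∀ n, p n = (∏ j ∈ Finset.Ioc N n, lam j) * k n) : ¬ Summable fun n => p n ^ 2 := by
  intro hs
  have hk2 : Tendsto (fun n => k n ^ 2) atTop (𝓝 0) := by
    refine squeeze_zero (fun _ => sq_nonneg _) (fun n => ?_) hs.tendsto_atTop_zero
    rw [hk n, mul_pow, ← sq_abs (∏ j ∈ Finset.Ioc N n, lam j), Finset.abs_prod]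
    refine le_mul_of_one_le_left (sq_nonneg _) (one_le_pow₀ ?_)
    rw [← Finset.prod_const_one (s := Finset.Ioc N n) (M := ℝ)]
    exact Finset.prod_le_prod (fun _ _ => zero_le_one)
      fun j hj => (hlam1 j (Finset.mem_Ioc.1 hj).1).le
  exact hl (pow_eq_zero_iff two_ne_zero |>.1 (tendsto_nhds_unique (hkl.pow 2) hk2))

end OPRL

end

/-! ### The dichotomy on the limit of `k`. -/

theorem theorem2p1 (μ : Measure ℝ) (a b : ℝ) (ha : a ≠ 0)
    (hμ : μ ∈ OPRL.NevaiClass a b)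
    (hbvA : OPRL.IsBV (OPRL.recA μ)) (hbvB : OPRL.IsBV (OPRL.recB μ))
    (x₀ : ℝ) (hx₀ : x₀ ∉ Set.Icc (b - 2 * a) (b + 2 * a)) :
    -- the limiting matrix `A_∞(x₀)` has exactly one eigenvalue of absolute value less than `1`
    (∃! z : ℝ, OPRL.IsContractingEigenvalue (OPRL.stepMatrix a b x₀) z) ∧
    -- for all large `j`, `A_j(x₀)` has exactly one eigenvalue of absolute value greater than `1`
    (∀ᶠ j : ℕ in atTop, ∃! z : ℝ, OPRL.IsExpandingEigenvalue (OPRL.recMatrix μ j x₀) z) ∧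
    -- first formula
    (∀ lamMinus : ℝ, OPRL.IsContractingEigenvalue (OPRL.stepMatrix a b x₀) lamMinus →
      (0 < μ {x₀} ↔
        ∀ ε : ℝ, 0 < ε → ∃ Cε : ℝ, ∀ n : ℕ,
          |(OPRL.orthonormalP μ n).eval x₀| ≤ Cε * (|lamMinus| + ε) ^ n)) ∧
    -- second formula
    (∀ (N : ℕ) (lamPlus : ℕ → ℝ),
      (∀ j : ℕ, N < j → OPRL.IsExpandingEigenvalue (OPRL.recMatrix μ j x₀) (lamPlus j)) →
      (μ {x₀} = 0 ↔
        ∃ (k : ℕ → ℝ) (kLim : ℝ), kLim ≠ 0 ∧ Tendsto k atTop (𝓝 kLim) ∧ OPRL.IsBV k ∧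
          ∀ n : ℕ, (OPRL.orthonormalP μ n).eval x₀ =
            (∏ j ∈ Finset.Ioc N n, lamPlus j) * k n)) := by

  obtain ⟨h, haT, hbT⟩ := hμ
  have hApos := OPRL.recA_pos h
  have ha0 : 0 < a := lt_of_le_of_ne (ge_of_tendsto' haT fun n => (hApos n).le) ha.symm
  have hτ := OPRL.two_lt_abs_sub_div ha0 hx₀
  have htT : Tendsto (fun n => (x₀ - OPRL.recB μ n) / OPRL.recA μ n) atTop
      (𝓝 ((x₀ - b) / a)) := (hbT.const_sub x₀).div haT ha
  have htBV := OPRL.isBV_sub_div (x := x₀) hApos ha0 haT hbT hbvA hbvB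
  have hcS := OPRL.summable_abs_one_sub_div hApos ha0 haT hbvA
  have hrec := OPRL.eval_orthonormalP_recurrence h x₀
  have hexp : ∀ᶠ j : ℕ in atTop, ∃! z : ℝ, OPRL.IsExpandingEigenvalue (OPRL.recMatrix μ j x₀) z := by
    filter_upwards [htT.abs.eventually (lt_mem_nhds hτ)] with j hj
    exact OPRL.existsUnique_isExpandingEigenvalue (hApos j).ne' hj
  have hcon := OPRL.existsUnique_isContractingEigenvalue ha hτ
  have main : ∀ (N : ℕ) (lamPlus : ℕ → ℝ) (w : ℝ),
      OPRL.IsContractingEigenvalue (OPRL.stepMatrix a b x₀) w →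
      (∀ j : ℕ, N < j → OPRL.IsExpandingEigenvalue (OPRL.recMatrix μ j x₀) (lamPlus j)) →
      ∃ (k : ℕ → ℝ) (l : ℝ), (∀ n, (OPRL.orthonormalP μ n).eval x₀ =
          (∏ j ∈ Finset.Ioc N n, lamPlus j) * k n) ∧ Tendsto k atTop (𝓝 l) ∧ OPRL.IsBV k ∧
        (l = 0 → ∀ ε : ℝ, 0 < ε → ∃ C : ℝ, ∀ n : ℕ,
          |(OPRL.orthonormalP μ n).eval x₀| ≤ C * (|w| + ε) ^ n) := by
    intro N lam w hw hlam
    have hroot : ∀ j > N, lam j ^ 2 - (x₀ - OPRL.recB μ j) / OPRL.recA μ j * lam j + 1 = 0 :=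
      fun j hj => (OPRL.hasEigenvalue_stepMatrix_iff (hApos j).ne' _ _ _).1 (hlam j hj).1
    have hP : ∀ n, ∏ j ∈ Finset.Ioc N n, lam j ≠ 0 := fun n => Finset.prod_ne_zero_iff.2
      fun j hj => OPRL.ne_zero_of_root (hroot j (Finset.mem_Ioc.1 hj).1)
    have hk : ∀ n, (OPRL.orthonormalP μ n).eval x₀ = (∏ j ∈ Finset.Ioc N n, lam j) *
        ((OPRL.orthonormalP μ n).eval x₀ / ∏ j ∈ Finset.Ioc N n, lam j) :=
      fun n => (mul_div_cancel₀ _ (hP n)).symm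
    obtain ⟨hkBV, hdecay⟩ := OPRL.ratio_isBV_and_decay htT htBV hcS
      ((OPRL.hasEigenvalue_stepMatrix_iff ha _ _ _).1 hw.1) hw.2 hrec hroot
      (fun j hj => (hlam j hj).2) hk
    obtain ⟨l, hl⟩ := hkBV.exists_tendsto
    exact ⟨_, l, hk, hl, hkBV, fun h0 => hdecay (h0 ▸ hl)⟩
  have atom_of_bound : ∀ w : ℝ, |w| < 1 → (∀ ε : ℝ, 0 < ε → ∃ C : ℝ, ∀ n : ℕ,
      |(OPRL.orthonormalP μ n).eval x₀| ≤ C * (|w| + ε) ^ n) → 0 < μ {x₀} := by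
    intro w hw hb
    -- Makes the rate `(1 + |w|)/2 < 1`, so the bound is square summable.
    obtain ⟨C, hC⟩ := hb ((1 - |w|) / 2) (by linarith)
    exact OPRL.atom_of_summable_sq h haT
      (OPRL.summable_sq_of_le_mul_pow (by linarith [abs_nonneg w]) (by linarith) hC)
  refine ⟨hcon, hexp, fun w hw => ⟨fun hpos => ?_, atom_of_bound w hw.2⟩,
    fun N lam hlam => ⟨fun h0 => ?_, ?_⟩⟩
  · obtain ⟨N, hN⟩ := eventually_atTop.1 hexp
    choose! lam hlam _ using hN
    obtain ⟨k, l, hk, hl, -, hdecay⟩ := main N lam w hw fun j hj => hlam j hj.le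
    -- At an atom the limit must be zero, since a nonzero one would contradict square summability.
    refine hdecay (by_contra fun hl0 => ?_)
    exact OPRL.not_summable_sq_of_ratio hl0 hl (fun j hj => (hlam j hj.le).2) hk
      (OPRL.summable_sq_of_atom h hpos)
  · obtain ⟨w, hw, -⟩ := hcon
    obtain ⟨k, l, hk, hl, hkBV, hdecay⟩ := main N lam w hw hlam
    exact ⟨k, l, fun hl0 => (atom_of_bound w hw.2 (hdecay hl0)).ne' h0, hl, hkBV, hk⟩
  · rintro ⟨k, l, hl0, hl, -, hk⟩
    by_contra hne
    exact OPRL.not_summable_sq_of_ratio hl0 hl (fun j hj => (hlam j hj).2) hk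
      (OPRL.summable_sq_of_atom h (pos_iff_ne_zero.2 hne))
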